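/- Let $d\ge 2$, and let $\Omega\subset\mathbb{R}^d$ be a bounded Lipschitz domain, that is, a bounded open set whose boundary is covered by finitely many bounded open sets $O_j$ such that $\Omega\cap O_j=\Omega_j\cap O_j$, where each $\Omega_j$ is, after a rigid motion, of the form $\{(x',x_d): x_d>\zeta_j(x')\}$ with $\zeta_j:\mathbb{R}^{d-1}\to\mathbb{R}$ Lipschitz (connectedness is not required). Let $1<p<\infty$ and $s\in(0,1]$ with $ps>1$. Put $\delta(x)=\operatorname{dist}(x,\partial\Omega)$ and, for $u\in L^p(\Omega)$, $$|u|_{\mathfrak{W}^{s,p}(\Omega)}^p=\int_\Omega\int_{\Omega\cap B_{\delta(x)}(x)}\frac{|u(y)-u(x)|^p}{\delta(x)^{d+ps}}\,dy\,dx,\qquad \|u\|_{\mathfrak{W}^{s,p}(\Omega)}=\left(\|u\|_{L^p(\Omega)}^p+|u|_{\mathfrak{W}^{s,p}(\Omega)}^p\right)^{1/p},$$ and let $\mathring{\mathfrak{W}}^{s,p}(\Omega)$ be the closure, with respect to $\|\cdot\|_{\mathfrak{W}^{s,p}(\Omega)}$, of the set $C^{0,1}_c(\Omega)$ of Lipschitz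 functions with compact support in $\Omega$, inside the space of real-valued $u\in L^p(\Omega)$ with $\|u\|_{\mathfrak{W}^{s,p}(\Omega)}<\infty$. Then there is a constant $C_P>0$ such that $$\|u\|_{L^p(\Omega)}\le C_P\,|u|_{\mathfrak{W}^{s,p}(\Omega)}\qquad\text{for all } u\in\mathring{\mathfrak{W}}^{s,p}(\Omega).$$ -/

import Mathlib

open Set MeasureTheory
open scoped ENNReal NNReal

noncomputable section

/-- The Lipschitz hypograph `{(x', t) : t > ζ x'}` in `ℝ^{d-1} × ℝ` (with the Euclidean norm). -/
def hypograph {d : ℕ} (ζ : EuclideanSpace ℝ (Fin (d - 1)) → ℝ) :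
    Set (WithLp 2 (EuclideanSpace ℝ (Fin (d - 1)) × ℝ)) :=
  {z | ζ z.fst < z.snd}

/-- `G ⊆ ℝ^d` is, after a rigid motion (an isometry `Φ` of `ℝ^d` onto `ℝ^{d-1} × ℝ`),
the hypograph of a Lipschitz function. -/
def IsLipschitzHypograph {d : ℕ} (G : Set (EuclideanSpace ℝ (Fin d))) : Prop :=
  ∃ (Φ : EuclideanSpace ℝ (Fin d) ≃ᵢ WithLp 2 (EuclideanSpace ℝ (Fin (d - 1)) × ℝ))
    (ζ : EuclideanSpace ℝ (Fin (d - 1)) → ℝ) (L : ℝ≥0),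
    LipschitzWith L ζ ∧ Φ '' G = hypograph ζ

/-- Lipschitz domains: open sets with compact boundary, such that the boundary is covered by
finitely many bounded open sets `O j` on each of which `Ω` agrees with a (rigidly moved)
Lipschitz hypograph `G j`. Connectedness is not required. -/
def IsLipschitzDomain {d : ℕ} (Ω : Set (EuclideanSpace ℝ (Fin d))) : Prop :=
  IsOpen Ω ∧ IsCompact (frontier Ω) ∧
    ∃ (N : ℕ) (O G : Fin N → Set (EuclideanSpace ℝ (Fin d))),
      (∀ j, IsOpen (O j) ∧ Bornology.IsBounded (O j)) ∧
      frontier Ω ⊆ ⋃ j, O j ∧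
      (∀ j, IsLipschitzHypograph (G j)) ∧
      ∀ j, Ω ∩ O j = G j ∩ O j

/-- The distance `δ(x) = dist(x, ∂Ω)` to the boundary. -/
def bdryDist {d : ℕ} (Ω : Set (EuclideanSpace ℝ (Fin d))) (x : EuclideanSpace ℝ (Fin d)) : ℝ :=
  Metric.infDist x (frontier Ω)

/-- The seminorm `|u|_{𝔚^{s,p}(Ω)}`, with values in `[0, ∞]`:
the `p`-th root of `∫_Ω ∫_{Ω ∩ B_{δ(x)}(x)} |u(y) - u(x)|^p / δ(x)^{d+ps} dy dx`. -/
def nonlocalSeminorm {d : ℕ} (Ω : Set (EuclideanSpace ℝ (Fin d))) (s p : ℝ)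
    (u : EuclideanSpace ℝ (Fin d) → ℝ) : ℝ≥0∞ :=
  (∫⁻ x in Ω, ∫⁻ y in Ω ∩ Metric.ball x (bdryDist Ω x),
    ENNReal.ofReal (|u y - u x| ^ p / bdryDist Ω x ^ ((d : ℝ) + p * s))) ^ (1 / p)

/-- The norm `‖u‖_{L^p(Ω)}`, with values in `[0, ∞]`. -/
def lpNormOn {d : ℕ} (Ω : Set (EuclideanSpace ℝ (Fin d))) (p : ℝ)
    (u : EuclideanSpace ℝ (Fin d) → ℝ) : ℝ≥0∞ :=
  eLpNorm u (ENNReal.ofReal p) (volume.restrict Ω)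

/-- The norm `‖u‖_{𝔚^{s,p}(Ω)} = (‖u‖_{L^p(Ω)}^p + |u|_{𝔚^{s,p}(Ω)}^p)^{1/p}`. -/
def nonlocalNorm {d : ℕ} (Ω : Set (EuclideanSpace ℝ (Fin d))) (s p : ℝ)
    (u : EuclideanSpace ℝ (Fin d) → ℝ) : ℝ≥0∞ :=
  (lpNormOn Ω p u ^ p + nonlocalSeminorm Ω s p u ^ p) ^ (1 / p)

/-- `C_c^{0,1}(Ω)`: Lipschitz functions whose support is a compact subset of `Ω`
(extended by zero to `ℝ^d`). -/
def IsLipschitzCompactlySupportedIn {d : ℕ} (Ω : Set (EuclideanSpace ℝ (Fin d)))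
    (φ : EuclideanSpace ℝ (Fin d) → ℝ) : Prop :=
  (∃ L : ℝ≥0, LipschitzWith L φ) ∧ HasCompactSupport φ ∧ tsupport φ ⊆ Ω

/-- `u ∈ 𝔚̊^{s,p}(Ω)`: `u ∈ L^p(Ω)`, the seminorm of `u` is finite, and `u` lies in the closure
of `C_c^{0,1}(Ω)` for the norm `‖·‖_{𝔚^{s,p}(Ω)}`. Only the restriction of `u` to `Ω`, up to
null sets, matters. -/
def MemNonlocalZero {d : ℕ} (Ω : Set (EuclideanSpace ℝ (Fin d))) (s p : ℝ)
    (u : EuclideanSpace ℝ (Fin d) → ℝ) : Prop :=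
  MemLp u (ENNReal.ofReal p) (volume.restrict Ω) ∧ nonlocalSeminorm Ω s p u < ∞ ∧
    ∀ ε : ℝ≥0∞, 0 < ε → ∃ φ : EuclideanSpace ℝ (Fin d) → ℝ,
      IsLipschitzCompactlySupportedIn Ω φ ∧ nonlocalNorm Ω s p (u - φ) < ε

end

/-! Write σ = ps and let E be the `p`-th power of the seminorm. Near a boundary point, let I(r) be
the integral of |φ|^p over the layer of heights in (r, 2r] above the boundary graph, with φ
Lipschitz and compactly supported in Ω. Sliding the two halves of this layer down onto (r/2, r]
gives I(r) ≤ 2κ I(r/2) + C r^σ E for any κ > 1. Since σ > 1, κ can be taken so close to 1 that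
2κ·2^(-σ) < 1. As I vanishes for small r, iteration yields I(r) ≤ B r^σ E with B independent of φ,
and this is summable over dyadic r (`IsBoundaryChart.exists_lintegral_chartLayer_le`).

The cost of sliding is controlled by E although the kernel only reaches to distance δ(x): for a
short translation v, φ(x+v) and φ(x) are both compared with the values of φ on a small ball seen
from both points (`lintegral_sub_translate_le`), and a shift of length at most r is a bounded number
of such translations.

The same comparison carries the local inequality from the boundary into the interior
(`hasLocalPoincare_of_mem`). Compactness of the closure of Ω makes it global, and density extends it
to the closure of the test functions. -/

/-- The `p`-th power of the nonlocal seminorm, with a general exponent `α` in the kernel. -/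
noncomputable def nonlocalEnergy {d : ℕ} (Ω : Set (EuclideanSpace ℝ (Fin d))) (α p : ℝ)
    (u : EuclideanSpace ℝ (Fin d) → ℝ) : ℝ≥0∞ :=
  ∫⁻ x in Ω, ∫⁻ y in Ω ∩ Metric.ball x (bdryDist Ω x),
    ENNReal.ofReal (|u y - u x| ^ p / bdryDist Ω x ^ α)

/-! ### Elementary inequalities for `p`-th powers -/

/-- Convexity of t^p applied to a + b = θ(a/θ) + η(b/η) with θ + η = 1. The weight θ is chosen so
that θ^(1-p) = κ. A coefficient arbitrarily close to 1 is what the layer recursion needs. -/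
theorem ENNReal.exists_rpow_add_le {p κ : ℝ} (hp : 1 < p) (hκ : 1 < κ) :
    ∃ C : ℝ≥0, ∀ a b : ℝ≥0∞, (a + b) ^ p ≤ ENNReal.ofReal κ * a ^ p + C * b ^ p := by
  obtain ⟨θ, hθ⟩ : ∃ θ : ℝ≥0, (θ : ℝ) = κ ^ (-(1 / (p - 1))) :=
    ⟨⟨κ ^ (-(1 / (p - 1))), by positivity⟩, rfl⟩
  have hp' : 0 < p - 1 := by linarith
  have hθ0 : 0 < θ := by
    rw [← NNReal.coe_pos, hθ]; positivity
  have hθ1 : θ < 1 := by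
    rw [← NNReal.coe_lt_coe, hθ]
    exact Real.rpow_lt_one_of_one_lt_of_neg hκ (by simp [hp'])
  obtain ⟨η, hη⟩ : ∃ η : ℝ≥0, θ + η = 1 := ⟨1 - θ, add_tsub_cancel_of_le hθ1.le⟩
  have hη0 : 0 < η := by
    rcases eq_or_ne η 0 with h | h
    · simp [h] at hη; simp [hη] at hθ1
    · exact pos_iff_ne_zero.2 h
  have key : θ * (θ⁻¹) ^ p = κ.toNNReal := by
    rw [← NNReal.coe_inj]
    push_cast
    rw [Real.coe_toNNReal _ (by linarith), hθ, ← Real.rpow_neg (by linarith),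
      ← Real.rpow_mul (by linarith), ← Real.rpow_add (by linarith)]
    have : -(1 / (p - 1)) + - -(1 / (p - 1)) * p = 1 := by field_simp; ring
    rw [this, Real.rpow_one]
  refine ⟨η * (η⁻¹) ^ p, fun a b => ?_⟩
  have h := ENNReal.rpow_arith_mean_le_arith_mean2_rpow θ η ((θ⁻¹ : ℝ≥0) * a) ((η⁻¹ : ℝ≥0) * b)
    (by exact_mod_cast hη) hp.le
  rw [← mul_assoc, ← mul_assoc, ← ENNReal.coe_mul, ← ENNReal.coe_mul, mul_inv_cancel₀ hθ0.ne',
    mul_inv_cancel₀ hη0.ne', ENNReal.mul_rpow_of_nonneg _ _ (by linarith),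
    ENNReal.mul_rpow_of_nonneg _ _ (by linarith), ← mul_assoc, ← mul_assoc,
    ← ENNReal.coe_rpow_of_nonneg _ (by linarith), ← ENNReal.coe_rpow_of_nonneg _ (by linarith),
    ← ENNReal.coe_mul, ← ENNReal.coe_mul, key] at h
  simpa [ENNReal.ofReal] using h

theorem ENNReal.rpow_add_le_two_rpow {p : ℝ} (hp : 1 ≤ p) (a b : ℝ≥0∞) :
    (a + b) ^ p ≤ 2 ^ p * (a ^ p + b ^ p) := by
  refine (ENNReal.rpow_add_le_mul_rpow_add_rpow a b hp).trans ?_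
  gcongr
  · exact one_le_two
  · linarith

/-! ### Boundary distance and translation estimates -/

section

variable {d : ℕ}

theorem setLIntegral_comp_add_right (F : EuclideanSpace ℝ (Fin d) → ℝ≥0∞)
    (v : EuclideanSpace ℝ (Fin d)) (A : Set (EuclideanSpace ℝ (Fin d))) :
    ∫⁻ x in (fun x => x + v) ⁻¹' A, F (x + v) = ∫⁻ x in A, F x :=
  (measurePreserving_add_right volume v).setLIntegral_comp_preimage_emb
    (measurableEmbedding_addRight v) F A

theorem setLIntegral_ball_comp_add (F : EuclideanSpace ℝ (Fin d) → ℝ≥0∞)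
    (x : EuclideanSpace ℝ (Fin d)) (ρ : ℝ) :
    ∫⁻ h in Metric.ball 0 ρ, F (x + h) = ∫⁻ y in Metric.ball x ρ, F y := by
  rw [← setLIntegral_comp_add_right F x]
  simp [add_comm]

/-- The ball of radius δ(x) about x is connected and misses the boundary, so it cannot leave Ω. -/
theorem mem_of_dist_lt_bdryDist {Ω : Set (EuclideanSpace ℝ (Fin d))}
    {x y : EuclideanSpace ℝ (Fin d)} (hx : x ∈ Ω) (hy : dist y x < bdryDist Ω x) : y ∈ Ω := by
  by_contra hyΩ
  have hconn : IsPreconnected (Metric.ball x (bdryDist Ω x)) :=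
    (convex_ball x _).isPreconnected
  have hpos : 0 < bdryDist Ω x := dist_nonneg.trans_lt hy
  have hf : ∀ w ∈ Metric.ball x (bdryDist Ω x), w ∉ frontier Ω := fun w hw hwf => by
    rw [Metric.mem_ball, dist_comm] at hw
    exact absurd hw (not_lt.2 (Metric.infDist_le_dist_of_mem hwf))
  have hcover : ∀ w ∈ Metric.ball x (bdryDist Ω x), w ∈ interior Ω ∨ w ∉ closure Ω :=
    fun w hw => by
      by_contra! h
      exact hf w hw ⟨h.2, h.1⟩
  have hxb : x ∈ Metric.ball x (bdryDist Ω x) := Metric.mem_ball_self hpos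
  obtain ⟨w, -, hw1, hw2⟩ := hconn (interior Ω) (closure Ω)ᶜ isOpen_interior
    isClosed_closure.isOpen_compl hcover
    ⟨x, hxb, (hcover x hxb).resolve_right fun h => h (subset_closure hx)⟩
    ⟨y, hy, (hcover y hy).resolve_left fun h => hyΩ (interior_subset h)⟩
  exact hw2 (subset_closure (interior_subset hw1))

theorem bdryDist_pos {Ω : Set (EuclideanSpace ℝ (Fin d))} (hΩ : IsOpen Ω)
    (hne : (frontier Ω).Nonempty) {x : EuclideanSpace ℝ (Fin d)} (hx : x ∈ Ω) :
    0 < bdryDist Ω x := by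
  refine (isClosed_frontier.notMem_iff_infDist_pos hne).1 fun h => ?_
  rw [hΩ.frontier_eq] at h
  exact h.2 hx

theorem continuous_bdryDist (Ω : Set (EuclideanSpace ℝ (Fin d))) : Continuous (bdryDist Ω) :=
  Metric.continuous_infDist_pt _

theorem enorm_rpow_le_mul_ofReal_div {a p α δ H : ℝ} (hp : 0 ≤ p) (hα : 0 ≤ α) (hδ : 0 < δ)
    (hH : δ ≤ H) :
    ‖a‖ₑ ^ p ≤ ENNReal.ofReal (H ^ α) * ENNReal.ofReal (|a| ^ p / δ ^ α) := by
  rw [← ofReal_norm, ENNReal.ofReal_rpow_of_nonneg (norm_nonneg _) hp,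
    ← ENNReal.ofReal_mul (Real.rpow_nonneg (hδ.le.trans hH) _), Real.norm_eq_abs]
  refine ENNReal.ofReal_le_ofReal ?_
  rw [mul_div_assoc', le_div_iff₀ (by positivity), mul_comm]
  gcongr

/-- The ball of radius ρ about x + w lies inside the ball of radius δ(x) about x, where the kernel
is at least H^(-α). -/
theorem lintegral_translate_le_nonlocalEnergy {Ω A : Set (EuclideanSpace ℝ (Fin d))} {α p ρ H : ℝ}
    (hp : 0 ≤ p) (hα : 0 ≤ α) (hΩ : MeasurableSet Ω) (hA : MeasurableSet A)
    (w : EuclideanSpace ℝ (Fin d)) (hρ : 0 < ρ)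
    (h : ∀ x ∈ A, x ∈ Ω ∧ ‖w‖ + ρ ≤ bdryDist Ω x ∧ bdryDist Ω x ≤ H)
    (u : EuclideanSpace ℝ (Fin d) → ℝ) :
    ∫⁻ x in A, ∫⁻ y in Metric.ball 0 ρ, ‖u (x + w + y) - u x‖ₑ ^ p ≤
      ENNReal.ofReal (H ^ α) * nonlocalEnergy Ω α p u := by
  have hAΩ : A ⊆ Ω := fun x hx => (h x hx).1
  rw [nonlocalEnergy, ← lintegral_const_mul' _ _ ENNReal.ofReal_ne_top]
  refine le_trans (setLIntegral_mono' hA fun x hx => ?_) (lintegral_mono_set hAΩ)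
  obtain ⟨hxΩ, hxρ, hxH⟩ := h x hx
  have hpos : 0 < bdryDist Ω x := by linarith [norm_nonneg w]
  rw [setLIntegral_ball_comp_add (fun y => ‖u y - u x‖ₑ ^ p) (x + w) ρ,
    ← lintegral_const_mul' _ _ ENNReal.ofReal_ne_top]
  have hsub : Metric.ball (x + w) ρ ⊆ Ω ∩ Metric.ball x (bdryDist Ω x) := by
    have : Metric.ball (x + w) ρ ⊆ Metric.ball x (bdryDist Ω x) :=
      Metric.ball_subset_ball' (by simp [dist_eq_norm]; linarith)
    exact fun y hy => ⟨mem_of_dist_lt_bdryDist hxΩ (this hy), this hy⟩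
  refine (lintegral_mono_set hsub).trans
    (setLIntegral_mono' (hΩ.inter measurableSet_ball) fun y _ => ?_)
  exact enorm_rpow_le_mul_ofReal_div hp hα hpos hxH

/-- For y in the ball of radius ρ about 0, the point x + y is visible from both x and x + v.
Inserting u(x + y) between u(x + v) and u(x) and averaging over y leaves two terms, each bounded by
the energy. -/
theorem lintegral_sub_translate_le {Ω A : Set (EuclideanSpace ℝ (Fin d))} {α p ρ H : ℝ}
    (hp : 1 ≤ p) (hα : 0 ≤ α) (hΩ : MeasurableSet Ω) (hA : MeasurableSet A)
    (v : EuclideanSpace ℝ (Fin d)) (hρ : 0 < ρ)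
    (h : ∀ x ∈ A, x ∈ Ω ∧ ρ ≤ bdryDist Ω x ∧ bdryDist Ω x ≤ H)
    (h' : ∀ x ∈ A, x + v ∈ Ω ∧ ‖v‖ + ρ ≤ bdryDist Ω (x + v) ∧ bdryDist Ω (x + v) ≤ H)
    {u : EuclideanSpace ℝ (Fin d) → ℝ} (hu : Continuous u) :
    ∫⁻ x in A, ‖u (x + v) - u x‖ₑ ^ p ≤
      2 ^ p * 2 * ENNReal.ofReal (H ^ α) / volume (Metric.ball (0 : EuclideanSpace ℝ (Fin d)) ρ) *
        nonlocalEnergy Ω α p u := by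
  have hp0 : 0 ≤ p := by linarith
  set B := Metric.ball (0 : EuclideanSpace ℝ (Fin d)) ρ with hB
  have hB0 : volume B ≠ 0 := (Metric.measure_ball_pos _ _ hρ).ne'
  have hBt : volume B ≠ ∞ := measure_ball_lt_top.ne
  have hum : Measurable u := hu.measurable
  have h2 : (2 : ℝ≥0∞) ^ p ≠ ∞ := by simp
  set A' := (fun x => x + -v) ⁻¹' A with hA'
  have hA'm : MeasurableSet A' := hA.preimage (measurable_add_const _)
  have e1 := lintegral_translate_le_nonlocalEnergy (ρ := ρ) (H := H) hp0 hα hΩ hA 0 hρ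
    (by simpa using h) u
  -- The differences seen from x + v: the base points range over A + v, and the offset -v recentres
  -- the ball at x.
  have e2 := lintegral_translate_le_nonlocalEnergy (ρ := ρ) (H := H) hp0 hα hΩ hA'm (-v) hρ
    (fun x hx => by simpa [hA'] using h' _ hx) u
  rw [← setLIntegral_comp_add_right _ v A'] at e2
  have hpre : (fun x => x + v) ⁻¹' A' = A := by ext x; simp [hA']
  rw [hpre] at e2
  have key : ∀ x, volume B * ‖u (x + v) - u x‖ₑ ^ p ≤
      2 ^ p * ((∫⁻ y in B, ‖u (x + 0 + y) - u x‖ₑ ^ p) +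
        ∫⁻ y in B, ‖u (x + v + -v + y) - u (x + v)‖ₑ ^ p) := by
    intro x
    rw [← lintegral_add_left (by fun_prop), ← lintegral_const_mul' _ _ h2,
      mul_comm, ← setLIntegral_const]
    refine lintegral_mono fun y => ?_
    refine le_trans ?_ (ENNReal.rpow_add_le_two_rpow hp _ _)
    gcongr
    have : u (x + v) - u x = (u (x + 0 + y) - u x) - (u (x + v + -v + y) - u (x + v)) := by
      simp
    rw [this]
    exact enorm_sub_le
  have hm : Measurable fun x => ∫⁻ y in B, ‖u (x + 0 + y) - u x‖ₑ ^ p := by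
    refine Measurable.lintegral_prod_right' (f := fun z : _ × _ => ‖u (z.1 + 0 + z.2) - u z.1‖ₑ ^ p) ?_
    fun_prop
  have tot : volume B * ∫⁻ x in A, ‖u (x + v) - u x‖ₑ ^ p ≤
      2 ^ p * (ENNReal.ofReal (H ^ α) * nonlocalEnergy Ω α p u +
        ENNReal.ofReal (H ^ α) * nonlocalEnergy Ω α p u) := by
    rw [← lintegral_const_mul' _ _ hBt]
    refine (lintegral_mono key).trans ?_
    rw [lintegral_const_mul' _ _ h2, lintegral_add_left hm]
    gcongr
  rw [← ENNReal.mul_div_right_comm, ENNReal.le_div_iff_mul_le (Or.inl hB0) (Or.inl hBt), mul_comm]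
  refine tot.trans_eq ?_
  ring

/-! ### Local Poincaré inequalities and their propagation into the interior -/

/-- `Ω` satisfies a local Poincaré inequality near `z`, on functions vanishing at the boundary. -/
def HasLocalPoincare (Ω : Set (EuclideanSpace ℝ (Fin d))) (α p : ℝ)
    (z : EuclideanSpace ℝ (Fin d)) : Prop :=
  ∃ U ∈ nhds z, ∃ C : ℝ≥0∞, C ≠ ∞ ∧ ∀ φ, IsLipschitzCompactlySupportedIn Ω φ →
    ∫⁻ x in Ω ∩ U, ‖φ x‖ₑ ^ p ≤ C * nonlocalEnergy Ω α p φ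

theorem IsLipschitzCompactlySupportedIn.continuous {Ω : Set (EuclideanSpace ℝ (Fin d))}
    {φ : EuclideanSpace ℝ (Fin d) → ℝ} (h : IsLipschitzCompactlySupportedIn Ω φ) :
    Continuous φ :=
  h.1.choose_spec.continuous

theorem bdryDist_le_add (Ω : Set (EuclideanSpace ℝ (Fin d))) (x y : EuclideanSpace ℝ (Fin d)) :
    bdryDist Ω x ≤ bdryDist Ω y + dist x y :=
  Metric.infDist_le_infDist_add_dist

/-- A small ball about x is translated onto one about y, where the inequality is known; the error is
the translation estimate, available because x is visible from y. -/
theorem HasLocalPoincare.of_dist_lt {Ω : Set (EuclideanSpace ℝ (Fin d))} {α p : ℝ} (hp : 1 ≤ p)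
    (hα : 0 ≤ α) (hΩ : IsOpen Ω) (hne : (frontier Ω).Nonempty) {x y : EuclideanSpace ℝ (Fin d)}
    (hx : x ∈ Ω) (hy : y ∈ Ω) (hxy : dist x y < bdryDist Ω y) (h : HasLocalPoincare Ω α p y) :
    HasLocalPoincare Ω α p x := by
  obtain ⟨U, hU, C, hC, hUC⟩ := h
  obtain ⟨r₀, hr₀, hrU⟩ := Metric.mem_nhds_iff.1 hU
  have hδx := bdryDist_pos hΩ hne hx
  have hδy := bdryDist_pos hΩ hne hy
  obtain ⟨ρ, hρ, h1, h2, h3⟩ : ∃ ρ > 0, ρ ≤ r₀ ∧ 2 * ρ ≤ bdryDist Ω x ∧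
      dist x y + 2 * ρ ≤ bdryDist Ω y := by
    refine ⟨min r₀ (min (bdryDist Ω x / 2) ((bdryDist Ω y - dist x y) / 2)), ?_, ?_, ?_, ?_⟩
    · have : 0 < (bdryDist Ω y - dist x y) / 2 := by linarith
      positivity
    · exact min_le_left _ _
    · have := (min_le_right r₀ (min (bdryDist Ω x / 2) ((bdryDist Ω y - dist x y) / 2))).trans
        (min_le_left _ _)
      linarith
    · have := (min_le_right r₀ (min (bdryDist Ω x / 2) ((bdryDist Ω y - dist x y) / 2))).trans
        (min_le_right _ _)
      linarith
  set H := bdryDist Ω x + bdryDist Ω y with hH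
  have h2p : (2 : ℝ≥0∞) ^ p ≠ ∞ := by simp
  refine ⟨Metric.ball x ρ, Metric.ball_mem_nhds _ hρ, 2 ^ p * (C + 2 ^ p * 2 *
    ENNReal.ofReal (H ^ α) / volume (Metric.ball (0 : EuclideanSpace ℝ (Fin d)) ρ)), ?_, ?_⟩
  · refine ENNReal.mul_ne_top h2p (ENNReal.add_ne_top.2 ⟨hC, ENNReal.div_ne_top ?_ ?_⟩)
    · exact ENNReal.mul_ne_top (ENNReal.mul_ne_top h2p (by simp)) ENNReal.ofReal_ne_top
    · exact (Metric.measure_ball_pos _ _ hρ).ne'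
  intro φ hφ
  have hm : Measurable φ := hφ.continuous.measurable
  set v := y - x with hv
  have hnv : ‖v‖ = dist x y := by rw [hv, dist_comm, dist_eq_norm]
  have hsub : ∀ w ∈ Metric.ball x ρ, dist (w + v) y < ρ := fun w hw => by
    have : w + v - y = w - x := by rw [hv]; abel
    rw [dist_eq_norm, this, ← dist_eq_norm]
    exact hw
  have hT := lintegral_sub_translate_le (Ω := Ω) (A := Metric.ball x ρ) (H := H) hp hα
    hΩ.measurableSet measurableSet_ball v hρ (fun w hw => ?_) (fun w hw => ?_) hφ.continuous
  rotate_left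
  · have hw' : dist w x < ρ := hw
    have e1 := bdryDist_le_add Ω x w
    have e2 := bdryDist_le_add Ω w x
    rw [dist_comm] at e1
    have := dist_nonneg (x := x) (y := y)
    exact ⟨mem_of_dist_lt_bdryDist hx (by linarith), by linarith, by linarith⟩
  · have hw' := hsub w hw
    have e1 := bdryDist_le_add Ω y (w + v)
    have e2 := bdryDist_le_add Ω (w + v) y
    rw [dist_comm] at e1
    have := dist_nonneg (x := x) (y := y)
    exact ⟨mem_of_dist_lt_bdryDist hy (by linarith), by linarith, by linarith⟩
  have hfirst : ∫⁻ w in Metric.ball x ρ, ‖φ (w + v)‖ₑ ^ p ≤ C * nonlocalEnergy Ω α p φ := by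
    refine le_trans ?_ (hUC φ hφ)
    rw [← setLIntegral_comp_add_right (fun w => ‖φ w‖ₑ ^ p) v (Ω ∩ U)]
    refine lintegral_mono_set fun w hw => ?_
    have hw' := hsub w hw
    have := dist_nonneg (x := x) (y := y)
    exact ⟨mem_of_dist_lt_bdryDist hy (by linarith), hrU (Metric.mem_ball.2 (by linarith))⟩
  calc ∫⁻ w in Ω ∩ Metric.ball x ρ, ‖φ w‖ₑ ^ p
      ≤ ∫⁻ w in Metric.ball x ρ, ‖φ w‖ₑ ^ p := lintegral_mono_set inter_subset_right
    _ ≤ ∫⁻ w in Metric.ball x ρ, 2 ^ p * (‖φ (w + v)‖ₑ ^ p + ‖φ (w + v) - φ w‖ₑ ^ p) := by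
        refine lintegral_mono fun w => le_trans ?_ (ENNReal.rpow_add_le_two_rpow hp _ _)
        gcongr
        calc ‖φ w‖ₑ = ‖φ (w + v) - (φ (w + v) - φ w)‖ₑ := by simp
          _ ≤ _ := enorm_sub_le
    _ ≤ _ := by
        rw [lintegral_const_mul' _ _ h2p, lintegral_add_left (by fun_prop), mul_assoc, add_mul]
        gcongr

/-- The inequality spreads from a nearest boundary point z to x along the segment joining them, in
finitely many steps. -/
theorem hasLocalPoincare_of_mem {Ω : Set (EuclideanSpace ℝ (Fin d))} {α p : ℝ} (hp : 1 ≤ p)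
    (hα : 0 ≤ α) (hΩ : IsOpen Ω) (hne : (frontier Ω).Nonempty)
    (h : ∀ z ∈ frontier Ω, HasLocalPoincare Ω α p z)
    {x : EuclideanSpace ℝ (Fin d)} (hx : x ∈ Ω) : HasLocalPoincare Ω α p x := by
  obtain ⟨z, hz, hxz⟩ := isClosed_frontier.exists_infDist_eq_dist hne x
  have hδ := bdryDist_pos hΩ hne hx
  have hnorm : ‖x - z‖ = bdryDist Ω x := by rw [← dist_eq_norm]; exact hxz.symm
  set γ : ℝ → EuclideanSpace ℝ (Fin d) := fun t => z + t • (x - z) with hγ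
  have hdist : ∀ a b, dist (γ a) (γ b) = |a - b| * bdryDist Ω x := fun a b => by
    have : γ a - γ b = (a - b) • (x - z) := by simp only [hγ]; module
    rw [dist_eq_norm, this, norm_smul, hnorm, Real.norm_eq_abs]
  have hγ1 : γ 1 = x := by simp [hγ]
  have hγ0 : γ 0 = z := by simp [hγ]
  have hmem : ∀ t, 0 < t → t ≤ 1 → γ t ∈ Ω := fun t h0 h1 => by
    refine mem_of_dist_lt_bdryDist hx ?_
    have := hdist t 1
    rw [hγ1, abs_sub_comm, abs_of_nonneg (by linarith)] at this
    rw [this]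
    nlinarith
  -- The boundary distance grows at full rate along the segment, since z is nearest to x.
  have hlow : ∀ t, 0 < t → t ≤ 1 → t * bdryDist Ω x ≤ bdryDist Ω (γ t) := fun t h0 h1 => by
    have := hdist 1 t
    rw [hγ1, abs_of_nonneg (by linarith)] at this
    have := bdryDist_le_add Ω x (γ t)
    linarith
  obtain ⟨U, hU, C, hC, hUC⟩ := h z hz
  have hcont : Continuous γ := by fun_prop
  have htend : Filter.Tendsto (fun k : ℕ => γ ((2 / 3 : ℝ) ^ k)) Filter.atTop (nhds z) := by
    rw [← hγ0]
    exact (hcont.tendsto 0).comp (tendsto_pow_atTop_nhds_zero_of_lt_one (by norm_num) (by norm_num))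
  obtain ⟨k, hk⟩ := (htend.eventually (eventually_mem_nhds_iff.2 hU)).exists
  have hbase : HasLocalPoincare Ω α p (γ ((2 / 3 : ℝ) ^ k)) := ⟨U, hk, C, hC, hUC⟩
  -- With ratio 2/3, consecutive points at parameters t and 2t/3 are tδ(x)/3 apart, less than the
  -- lower bound 2tδ(x)/3 for the boundary distance at the point nearer z.
  have hdown : ∀ k : ℕ, HasLocalPoincare Ω α p (γ ((2 / 3 : ℝ) ^ k)) →
      HasLocalPoincare Ω α p (γ 1) := by
    intro k
    induction k with
    | zero => simp
    | succ k ih =>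
      intro hk
      refine ih (HasLocalPoincare.of_dist_lt hp hα hΩ hne (hmem _ (by positivity)
        (pow_le_one₀ (by norm_num) (by norm_num))) (hmem _ (by positivity)
        (pow_le_one₀ (by norm_num) (by norm_num))) ?_ hk)
      refine lt_of_lt_of_le ?_ (hlow _ (by positivity) (pow_le_one₀ (by norm_num) (by norm_num)))
      have hpow : (0 : ℝ) < (2 / 3) ^ k := by positivity
      rw [hdist, pow_succ, abs_of_nonneg (by linarith)]
      nlinarith [mul_pos hpow hδ]
  rw [← hγ1]
  exact hdown k hbase

/-! ### Boundary charts and translation between layers -/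

/-- The height is the vertical distance above the graph, pulled back by the rigid motion. By
Mazur–Ulam the motion is affine, so the vertical unit vector pulls back to a fixed direction e. -/
theorem IsLipschitzHypograph.exists_height {G : Set (EuclideanSpace ℝ (Fin d))}
    (hG : IsLipschitzHypograph G) :
    ∃ (e : EuclideanSpace ℝ (Fin d)) (g : EuclideanSpace ℝ (Fin d) → ℝ) (M : ℝ),
      ‖e‖ = 1 ∧ 1 ≤ M ∧ (∀ x y, |g x - g y| ≤ M * dist x y) ∧
      (∀ x (t : ℝ), g (x + t • e) = g x + t) ∧ ∀ x, x ∈ G ↔ 0 < g x := by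
  obtain ⟨Φ, ζ, L, hζ, hΦ⟩ := hG
  set A := Φ.toRealAffineIsometryEquiv with hA
  have hAΦ : ∀ x, A x = Φ x := fun x => by simp [hA]
  set b : WithLp 2 (EuclideanSpace ℝ (Fin (d - 1)) × ℝ) := WithLp.toLp 2 (0, 1) with hb
  have hbn : ‖b‖ = 1 := by simp [hb]
  refine ⟨A.linearIsometryEquiv.symm b, fun x => (Φ x).snd - ζ (Φ x).fst, 1 + L, ?_, ?_, ?_, ?_, ?_⟩
  · rw [LinearIsometryEquiv.norm_map, hbn]
  · simp
  · intro x y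
    have h1 : dist (Φ x).fst (Φ y).fst ≤ dist x y := by
      rw [← Φ.dist_eq x y, dist_eq_norm, dist_eq_norm, ← WithLp.sub_fst]
      exact WithLp.norm_fst_le _ _
    have h2 : dist (Φ x).snd (Φ y).snd ≤ dist x y := by
      rw [← Φ.dist_eq x y, dist_eq_norm, dist_eq_norm, ← WithLp.sub_snd]
      exact WithLp.norm_snd_le _ _
    have h3 := hζ.dist_le_mul (Φ x).fst (Φ y).fst
    rw [Real.dist_eq] at h2 h3
    have h4 : (L : ℝ) * dist (Φ x).fst (Φ y).fst ≤ L * dist x y := by gcongr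
    calc |(Φ x).snd - ζ (Φ x).fst - ((Φ y).snd - ζ (Φ y).fst)|
        = |((Φ x).snd - (Φ y).snd) - (ζ (Φ x).fst - ζ (Φ y).fst)| := by congr 1; ring
      _ ≤ |(Φ x).snd - (Φ y).snd| + |ζ (Φ x).fst - ζ (Φ y).fst| := abs_sub _ _
      _ ≤ _ := by linarith
  · intro x t
    have : Φ (x + t • A.linearIsometryEquiv.symm b) = Φ x + t • b := by
      rw [← hAΦ, ← hAΦ, add_comm x, ← vadd_eq_add, A.map_vadd]
      simp [add_comm]
    simp only [this]
    simp [hb]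
    ring
  · intro x
    have : x ∈ G ↔ Φ x ∈ Φ '' G := (Φ.injective.mem_set_image).symm
    rw [this, hΦ]
    simp [hypograph]

theorem lintegral_sub_nsmul_le {X : ℝ≥0∞} {p : ℝ} (hp : 1 ≤ p)
    {φ : EuclideanSpace ℝ (Fin d) → ℝ} (hφ : Continuous φ) (v : EuclideanSpace ℝ (Fin d))
    (A : Set (EuclideanSpace ℝ (Fin d))) (n : ℕ)
    (h : ∀ i < n, ∫⁻ x in A, ‖φ (x + i • v + v) - φ (x + i • v)‖ₑ ^ p ≤ X) :
    ∫⁻ x in A, ‖φ (x + n • v) - φ x‖ₑ ^ p ≤ (2 ^ p * 2) ^ n * X := by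
  have hm : Measurable φ := hφ.measurable
  have h2p : (2 : ℝ≥0∞) ^ p ≠ ∞ := by simp
  have hc : 1 ≤ (2 : ℝ≥0∞) ^ p * 2 := by
    have : (1 : ℝ≥0∞) ≤ 2 ^ p := ENNReal.one_le_rpow (by norm_num) (by linarith)
    calc (1 : ℝ≥0∞) = 1 * 1 := by simp
      _ ≤ 2 ^ p * 2 := mul_le_mul' this one_le_two
  induction n with
  | zero => simp [show 0 < p by linarith]
  | succ n ih =>
    have ih' := ih fun i hi => h i (by omega)
    have hn := h n (by omega)
    calc ∫⁻ x in A, ‖φ (x + (n + 1) • v) - φ x‖ₑ ^ p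
        ≤ ∫⁻ x in A, 2 ^ p * (‖φ (x + n • v + v) - φ (x + n • v)‖ₑ ^ p
            + ‖φ (x + n • v) - φ x‖ₑ ^ p) := by
          refine lintegral_mono fun x => le_trans ?_ (ENNReal.rpow_add_le_two_rpow hp _ _)
          gcongr
          rw [add_smul, one_smul, ← add_assoc]
          calc _ = ‖(φ (x + n • v + v) - φ (x + n • v)) + (φ (x + n • v) - φ x)‖ₑ := by
                congr 1; ring
            _ ≤ _ := enorm_add_le _ _
      _ ≤ 2 ^ p * (X + (2 ^ p * 2) ^ n * X) := by
          rw [lintegral_const_mul' _ _ h2p, lintegral_add_left (by fun_prop)]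
          gcongr
      _ ≤ 2 ^ p * ((2 ^ p * 2) ^ n * X + (2 ^ p * 2) ^ n * X) := by
          gcongr
          exact le_mul_of_one_le_left' (one_le_pow₀ hc)
      _ = (2 ^ p * 2) ^ (n + 1) * X := by ring

/-- A boundary chart of `Ω` at `z`: in the ball `B_R(z)`, the set `Ω` is the positivity set of the
Lipschitz height function `g`, which grows at unit speed in the direction `e`. -/
structure IsBoundaryChart (Ω : Set (EuclideanSpace ℝ (Fin d))) (z e : EuclideanSpace ℝ (Fin d))
    (g : EuclideanSpace ℝ (Fin d) → ℝ) (M R : ℝ) : Prop where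
  isOpen : IsOpen Ω
  mem_frontier : z ∈ frontier Ω
  norm_eq : ‖e‖ = 1
  one_le : 1 ≤ M
  pos : 0 < R
  abs_sub_le : ∀ x y, |g x - g y| ≤ M * dist x y
  add_smul : ∀ x (t : ℝ), g (x + t • e) = g x + t
  mem_iff : ∀ x ∈ Metric.ball z R, x ∈ Ω ↔ 0 < g x

/-- The part of the cylinder around `z` in direction `e` where the height `g` lies in `(a, b]`. -/
def chartLayer (z e : EuclideanSpace ℝ (Fin d)) (g : EuclideanSpace ℝ (Fin d) → ℝ) (R a b : ℝ) :
    Set (EuclideanSpace ℝ (Fin d)) :=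
  {x | ‖x - g x • e - z‖ < R / 8 ∧ a < g x ∧ g x ≤ b}

namespace IsBoundaryChart

variable {Ω : Set (EuclideanSpace ℝ (Fin d))} {z e : EuclideanSpace ℝ (Fin d)}
  {g : EuclideanSpace ℝ (Fin d) → ℝ} {M R : ℝ}

theorem continuous (h : IsBoundaryChart Ω z e g M R) : Continuous g :=
  (LipschitzWith.of_dist_le_mul (K := ⟨M, by linarith [h.one_le]⟩) fun x y => by
    rw [Real.dist_eq]; exact h.abs_sub_le x y).continuous

theorem height_eq_zero (h : IsBoundaryChart Ω z e g M R) {w : EuclideanSpace ℝ (Fin d)}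
    (hw : w ∈ Metric.ball z R) (hwf : w ∈ frontier Ω) : g w = 0 := by
  rw [h.isOpen.frontier_eq] at hwf
  refine le_antisymm (not_lt.1 fun h0 => hwf.2 ((h.mem_iff w hw).2 h0)) (not_lt.1 fun h0 => ?_)
  have hopen : IsOpen (Metric.ball z R ∩ {x | g x < 0}) :=
    Metric.isOpen_ball.inter (isOpen_lt h.continuous continuous_const)
  obtain ⟨y, ⟨hy1, hy2⟩, hy3⟩ := mem_closure_iff.1 hwf.1 _ hopen ⟨hw, h0⟩
  have h1 := (h.mem_iff y hy1).1 hy3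
  have h2 : g y < 0 := hy2
  linarith

theorem mem_frontier_of_eq_zero (h : IsBoundaryChart Ω z e g M R) {w : EuclideanSpace ℝ (Fin d)}
    (hw : w ∈ Metric.ball z R) (hg : g w = 0) : w ∈ frontier Ω := by
  rw [h.isOpen.frontier_eq]
  refine ⟨?_, fun hwΩ => by have := (h.mem_iff w hw).1 hwΩ; linarith⟩
  have hcont : Continuous fun t : ℝ => w + t • e := by fun_prop
  have htend : Filter.Tendsto (fun t : ℝ => w + t • e) (nhdsWithin 0 (Ioi 0)) (nhds w) := by
    have := (hcont.tendsto 0).mono_left (nhdsWithin_le_nhds (s := Ioi 0))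
    simpa using this
  refine mem_closure_of_tendsto htend ?_
  filter_upwards [htend (Metric.isOpen_ball.mem_nhds hw), self_mem_nhdsWithin] with t ht ht0
  rw [h.mem_iff _ ht, h.add_smul, hg]
  simpa using ht0

theorem height_le_mul_bdryDist (h : IsBoundaryChart Ω z e g M R) {x : EuclideanSpace ℝ (Fin d)}
    (hx : x ∈ Metric.ball z (R / 2)) : g x / M ≤ bdryDist Ω x := by
  have hM := h.one_le
  have hz := h.height_eq_zero (Metric.mem_ball_self h.pos) h.mem_frontier
  refine (Metric.le_infDist ⟨z, h.mem_frontier⟩).2 fun w hw => ?_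
  rw [div_le_iff₀' (by linarith)]
  have hxz : dist x z < R / 2 := hx
  by_cases hwR : w ∈ Metric.ball z R
  -- Boundary points in the chart have height zero; those outside it are farther from x than z is.
  · have := (le_abs_self _).trans (h.abs_sub_le x w)
    rwa [h.height_eq_zero hwR hw, sub_zero] at this
  · have h1 := (le_abs_self _).trans (h.abs_sub_le x z)
    rw [hz, sub_zero] at h1
    have h2 : R ≤ dist w z := not_lt.1 hwR
    have h3 := dist_triangle w x z
    rw [dist_comm w x] at h3
    refine h1.trans ?_
    gcongr
    linarith

theorem of_mem_chartLayer (h : IsBoundaryChart Ω z e g M R) {a b : ℝ} (ha : 0 ≤ a)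
    (hb : b ≤ R / 8) {x : EuclideanSpace ℝ (Fin d)} (hx : x ∈ chartLayer z e g R a b) :
    x ∈ Ω ∧ g x / M ≤ bdryDist Ω x ∧ bdryDist Ω x ≤ g x := by
  obtain ⟨h1, h2, h3⟩ := hx
  have hR := h.pos
  have hxb : x ∈ Metric.ball z (R / 2) := by
    rw [Metric.mem_ball, dist_eq_norm]
    have : x - z = (x - g x • e - z) + g x • e := by abel
    rw [this]
    refine (norm_add_le _ _).trans_lt ?_
    rw [norm_smul, h.norm_eq, Real.norm_eq_abs, abs_of_nonneg (by linarith)]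
    linarith
  refine ⟨(h.mem_iff x (Metric.ball_subset_ball (by linarith) hxb)).2 (by linarith),
    h.height_le_mul_bdryDist hxb, ?_⟩
  -- The vertical projection of x onto the graph is a boundary point at distance g x.
  have hP : x - g x • e ∈ frontier Ω := by
    refine h.mem_frontier_of_eq_zero ?_ ?_
    · rw [Metric.mem_ball, dist_eq_norm]; linarith
    · rw [sub_eq_add_neg, ← neg_smul, h.add_smul]; ring
  refine (Metric.infDist_le_dist_of_mem hP).trans ?_
  rw [dist_eq_norm, sub_sub_cancel, norm_smul, h.norm_eq, Real.norm_eq_abs,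
    abs_of_nonneg (by linarith), mul_one]

theorem measurableSet_chartLayer (h : IsBoundaryChart Ω z e g M R) (a b : ℝ) :
    MeasurableSet (chartLayer z e g R a b) := by
  have hg := h.continuous
  have h1 : MeasurableSet {x | ‖x - g x • e - z‖ < R / 8} :=
    (isOpen_lt (by fun_prop) continuous_const).measurableSet
  have h2 : MeasurableSet {x | a < g x} := (isOpen_lt continuous_const hg).measurableSet
  have h3 : MeasurableSet {x | g x ≤ b} := (isClosed_le hg continuous_const).measurableSet
  exact h1.inter (h2.inter h3)

theorem add_smul_mem_chartLayer (h : IsBoundaryChart Ω z e g M R) (a b t : ℝ)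
    (x : EuclideanSpace ℝ (Fin d)) :
    x + t • e ∈ chartLayer z e g R a b ↔ x ∈ chartLayer z e g R (a - t) (b - t) := by
  simp only [chartLayer, mem_ofPred_eq, h.add_smul]
  have : x + t • e - (g x + t) • e - z = x - g x • e - z := by module
  rw [this, sub_lt_iff_lt_add, le_sub_iff_add_le]

theorem setLIntegral_chartLayer_comp (h : IsBoundaryChart Ω z e g M R)
    (F : EuclideanSpace ℝ (Fin d) → ℝ≥0∞) (a b t : ℝ) :
    ∫⁻ x in chartLayer z e g R a b, F (x + t • e) =
      ∫⁻ x in chartLayer z e g R (a + t) (b + t), F x := by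
  rw [← setLIntegral_comp_add_right F (t • e)]
  congr 2
  ext x
  simp [h.add_smul_mem_chartLayer]

/-- The scaling of the translation constant: r^(d+σ) from the kernel over r^d from the averaging
ball leaves r^σ. -/
theorem kernel_const_eq {r σ : ℝ} (hr : 0 < r) (hM : 1 ≤ M) :
    ENNReal.ofReal ((2 * r) ^ ((d : ℝ) + σ)) /
        volume (Metric.ball (0 : EuclideanSpace ℝ (Fin d)) (r / (4 * M))) =
      ENNReal.ofReal (2 ^ ((d : ℝ) + σ) * (4 * M) ^ d) /
        volume (Metric.ball (0 : EuclideanSpace ℝ (Fin d)) 1) * ENNReal.ofReal (r ^ σ) := by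
  have hq : 0 < r / (4 * M) := by positivity
  rw [Measure.addHaar_ball_of_pos _ _ hq, finrank_euclideanSpace_fin, ← ENNReal.mul_div_right_comm,
    ← ENNReal.ofReal_mul (by positivity), ENNReal.div_eq_inv_mul,
    ENNReal.mul_inv (Or.inr measure_ball_lt_top.ne) (Or.inl ENNReal.ofReal_ne_top),
    ← ENNReal.ofReal_inv_of_pos (by positivity), mul_right_comm,
    ← ENNReal.ofReal_mul (by positivity), ENNReal.div_eq_inv_mul, mul_comm]
  congr 2
  rw [Real.mul_rpow (by norm_num) hr.le, Real.rpow_add hr, Real.rpow_natCast, div_pow]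
  field_simp

/-- All layers crossed have height between r/2 and 2r, hence boundary distance at least r/(2M).
Cutting the shift into n ≥ 4M steps makes each step at most r/(4M), leaving room for an averaging
ball of the same radius. -/
theorem lintegral_sub_chartLayer_le (h : IsBoundaryChart Ω z e g M R) {p σ : ℝ} (hp : 1 ≤ p)
    (hσ : 0 ≤ σ) {n : ℕ} (hn : 4 * M ≤ n) {φ : EuclideanSpace ℝ (Fin d) → ℝ} (hφ : Continuous φ)
    {r a b t : ℝ} (hr : 0 < r) (hrR : 2 * r ≤ R / 8) (ht : 0 ≤ t) (htr : t ≤ r)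
    (ha : r / 2 ≤ a - t) (hb : b ≤ 2 * r) :
    ∫⁻ x in chartLayer z e g R a b, ‖φ (x + (-t) • e) - φ x‖ₑ ^ p ≤
      (2 ^ p * 2) ^ n * (2 ^ p * 2 * (ENNReal.ofReal (2 ^ ((d : ℝ) + σ) * (4 * M) ^ d) /
        volume (Metric.ball (0 : EuclideanSpace ℝ (Fin d)) 1)) * ENNReal.ofReal (r ^ σ) *
        nonlocalEnergy Ω (d + σ) p φ) := by
  have hM := h.one_le
  have hn0 : (0 : ℝ) < n := by linarith
  set v : EuclideanSpace ℝ (Fin d) := (-(t / n)) • e with hv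
  have hiv : ∀ i : ℕ, i • v = (-(i * (t / n))) • e := fun i => by
    rw [hv, ← Nat.cast_smul_eq_nsmul ℝ, smul_smul]; congr 1; ring
  have hnv : n • v = (-t) • e := by
    rw [hiv]; congr 2; field_simp
  have htn : 0 ≤ t / n := by positivity
  have hvn : ‖v‖ ≤ r / (4 * M) := by
    rw [hv, norm_smul, h.norm_eq, mul_one, norm_neg, Real.norm_eq_abs, abs_of_nonneg htn]
    exact div_le_div₀ hr.le htr (by linarith) hn
  rw [← hnv]
  refine lintegral_sub_nsmul_le hp hφ v _ n fun i hi => ?_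
  have hi1 : (i : ℝ) + 1 ≤ n := by exact_mod_cast hi
  have hi2 : ((i : ℝ) + 1) * (t / n) ≤ t := by
    calc ((i : ℝ) + 1) * (t / n) ≤ n * (t / n) := by gcongr
      _ = t := by field_simp
  have hi3 : 0 ≤ (i : ℝ) * (t / n) := by positivity
  rw [hiv, h.setLIntegral_chartLayer_comp (fun x => ‖φ (x + v) - φ x‖ₑ ^ p)]
  have hbound : ∀ x, r / 2 ≤ g x → g x / M ≤ bdryDist Ω x →
      r / (4 * M) + r / (4 * M) ≤ bdryDist Ω x := fun x h1 h2 => by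
    refine le_trans ?_ h2
    calc r / (4 * M) + r / (4 * M) = (r / 2) / M := by field_simp; norm_num
      _ ≤ g x / M := by gcongr
  have hpos : 0 < r / (4 * M) := by positivity
  have := lintegral_sub_translate_le (Ω := Ω) (α := d + σ) (p := p) (ρ := r / (4 * M))
    (H := 2 * r) hp (by positivity) h.isOpen.measurableSet
    (h.measurableSet_chartLayer (a + -(i * (t / n))) (b + -(i * (t / n)))) v hpos
    (fun x hx => ?_) (fun x hx => ?_) hφ
  · rwa [mul_div_assoc, kernel_const_eq hr hM, ← mul_assoc] at this
  · obtain ⟨h1, h2, h3⟩ := h.of_mem_chartLayer (by nlinarith) (by linarith) hx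
    obtain ⟨-, h4, h5⟩ := hx
    have := hbound x (by linarith) h2
    exact ⟨h1, by linarith, by linarith⟩
  · have hx' : x + v ∈ chartLayer z e g R (a + -((i + 1) * (t / n))) (b + -((i + 1) * (t / n))) := by
      rw [hv, h.add_smul_mem_chartLayer]
      convert hx using 2 <;> ring
    obtain ⟨h1, h2, h3⟩ := h.of_mem_chartLayer (by linarith) (by linarith) hx'
    obtain ⟨-, h4, h5⟩ := hx'
    have := hbound (x + v) (by linarith) h2
    exact ⟨h1, by linarith, by linarith⟩

end IsBoundaryChart

/-! ### The recursion over layers -/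

namespace IsBoundaryChart

variable {Ω : Set (EuclideanSpace ℝ (Fin d))} {z e : EuclideanSpace ℝ (Fin d)}
  {g : EuclideanSpace ℝ (Fin d) → ℝ} {M R : ℝ}

theorem exists_lintegral_chartLayer_le_translate (h : IsBoundaryChart Ω z e g M R) {p σ κ : ℝ}
    (hp : 1 < p) (hσ : 0 ≤ σ) (hκ : 1 < κ) :
    ∃ C : ℝ≥0∞, C ≠ ∞ ∧ ∀ φ : EuclideanSpace ℝ (Fin d) → ℝ, Continuous φ → ∀ r a b t : ℝ, 0 < r →
      2 * r ≤ R / 8 → 0 ≤ t → t ≤ r → r / 2 ≤ a - t → b ≤ 2 * r →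
      ∫⁻ x in chartLayer z e g R a b, ‖φ x‖ₑ ^ p ≤
        ENNReal.ofReal κ * (∫⁻ x in chartLayer z e g R (a - t) (b - t), ‖φ x‖ₑ ^ p) +
        C * ENNReal.ofReal (r ^ σ) * nonlocalEnergy Ω (d + σ) p φ := by
  obtain ⟨K, hK⟩ := ENNReal.exists_rpow_add_le hp hκ
  obtain ⟨n, hn⟩ := exists_nat_ge (4 * M)
  have h2p : (2 : ℝ≥0∞) ^ p ≠ ∞ := by simp
  refine ⟨K * ((2 ^ p * 2) ^ n * (2 ^ p * 2 * (ENNReal.ofReal (2 ^ ((d : ℝ) + σ) * (4 * M) ^ d) /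
        volume (Metric.ball (0 : EuclideanSpace ℝ (Fin d)) 1)))), ?_, ?_⟩
  · have h3 : (2 : ℝ≥0∞) ^ p * 2 ≠ ∞ := ENNReal.mul_ne_top h2p (by simp)
    exact ENNReal.mul_ne_top ENNReal.coe_ne_top (ENNReal.mul_ne_top (ENNReal.pow_ne_top h3)
      (ENNReal.mul_ne_top h3 (ENNReal.div_ne_top ENNReal.ofReal_ne_top
        (Metric.measure_ball_pos _ _ one_pos).ne')))
  intro φ hφ r a b t hr hrR ht htr ha hb
  have hm : Measurable φ := hφ.measurable
  have hD := h.lintegral_sub_chartLayer_le hp.le hσ hn hφ hr hrR ht htr ha hb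
  calc ∫⁻ x in chartLayer z e g R a b, ‖φ x‖ₑ ^ p
      ≤ ∫⁻ x in chartLayer z e g R a b, (ENNReal.ofReal κ * ‖φ (x + (-t) • e)‖ₑ ^ p +
          K * ‖φ (x + (-t) • e) - φ x‖ₑ ^ p) := by
        refine lintegral_mono fun x => le_trans ?_ (hK _ _)
        gcongr
        calc ‖φ x‖ₑ = ‖φ (x + (-t) • e) - (φ (x + (-t) • e) - φ x)‖ₑ := by simp
          _ ≤ _ := enorm_sub_le
    _ = ENNReal.ofReal κ * (∫⁻ x in chartLayer z e g R (a - t) (b - t), ‖φ x‖ₑ ^ p) +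
          K * ∫⁻ x in chartLayer z e g R a b, ‖φ (x + (-t) • e) - φ x‖ₑ ^ p := by
        rw [lintegral_add_left (by fun_prop), lintegral_const_mul' _ _ ENNReal.ofReal_ne_top,
          lintegral_const_mul' _ _ ENNReal.coe_ne_top,
          h.setLIntegral_chartLayer_comp (fun x => ‖φ x‖ₑ ^ p)]
        rfl
    _ ≤ _ := by
        refine add_le_add_right ((mul_le_mul_right hD _).trans_eq ?_) _
        ring

theorem exists_lintegral_chartLayer_eq_zero (h : IsBoundaryChart Ω z e g M R) {p : ℝ} (hp : 0 < p)
    {φ : EuclideanSpace ℝ (Fin d) → ℝ} (hφ : IsLipschitzCompactlySupportedIn Ω φ) :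
    ∃ r₀ > 0, ∀ r, 0 < r → 2 * r ≤ R / 8 → r ≤ r₀ →
      ∫⁻ x in chartLayer z e g R r (2 * r), ‖φ x‖ₑ ^ p = 0 := by
  obtain ⟨δ₀, hδ₀, hδ⟩ : ∃ δ₀ > 0, ∀ x ∈ tsupport φ, δ₀ ≤ bdryDist Ω x := by
    rcases (tsupport φ).eq_empty_or_nonempty with h0 | h0
    · exact ⟨1, one_pos, by simp [h0]⟩
    · obtain ⟨x, hx, hmin⟩ := IsCompact.exists_isMinOn hφ.2.1 h0 (continuous_bdryDist Ω).continuousOn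
      exact ⟨_, bdryDist_pos h.isOpen ⟨z, h.mem_frontier⟩ (hφ.2.2 hx), fun y hy => hmin hy⟩
  -- On the layer the boundary distance is at most 2r ≤ 2δ₀/3, so the support of φ is missed.
  refine ⟨δ₀ / 3, by positivity, fun r hr hrR hr0 => ?_⟩
  rw [setLIntegral_congr_fun (g := 0) (h.measurableSet_chartLayer _ _)]
  · simp
  intro x hx
  have hx0 : φ x = 0 := by
    by_contra hne
    have h1 := hδ x (subset_tsupport φ hne)
    obtain ⟨-, -, h3⟩ := h.of_mem_chartLayer hr.le hrR hx
    obtain ⟨-, -, h5⟩ := hx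
    linarith
  simp [hx0, hp]

theorem exists_lintegral_chartLayer_le (h : IsBoundaryChart Ω z e g M R) {p σ : ℝ}
    (hp : 1 < p) (hσ : 1 < σ) :
    ∃ C : ℝ≥0∞, C ≠ ∞ ∧ ∀ φ, IsLipschitzCompactlySupportedIn Ω φ → ∀ r : ℝ, 0 < r →
      2 * r ≤ R / 8 → ∫⁻ x in chartLayer z e g R r (2 * r), ‖φ x‖ₑ ^ p ≤
        C * ENNReal.ofReal (r ^ σ) * nonlocalEnergy Ω (d + σ) p φ := by
  -- With this κ the contraction factor 2κ·2^(-σ) equals 1/κ < 1; `B` below is the fixed point of B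
  -- = B/κ + 2C.
  set κ : ℝ := 2 ^ ((σ - 1) / 2) with hκ
  have hκ1 : 1 < κ := Real.one_lt_rpow (by norm_num) (by linarith)
  have hκ2 : 2 * κ * 2⁻¹ ^ σ = κ⁻¹ := by
    have : κ * κ * 2 = 2 ^ σ := by
      rw [hκ, ← Real.rpow_add (by norm_num), ← Real.rpow_add_one (by norm_num)]
      congr 1; ring
    rw [Real.inv_rpow (by norm_num), ← this]
    field_simp
  obtain ⟨C, hC, hCφ⟩ := h.exists_lintegral_chartLayer_le_translate (σ := σ) hp (by linarith) hκ1
  set B : ℝ≥0∞ := 2 * C * ENNReal.ofReal (κ / (κ - 1)) with hB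
  have hBeq : 2 * ENNReal.ofReal κ * ENNReal.ofReal (2⁻¹ ^ σ) * B + 2 * C = B := by
    have h2 : (2 : ℝ≥0∞) = ENNReal.ofReal 2 := by simp
    have hκ' : 0 < κ - 1 := by linarith
    have : 2 * ENNReal.ofReal κ * ENNReal.ofReal (2⁻¹ ^ σ) = ENNReal.ofReal κ⁻¹ := by
      rw [h2, ← ENNReal.ofReal_mul (by norm_num), ← ENNReal.ofReal_mul (by positivity), hκ2]
    rw [this, hB]
    calc ENNReal.ofReal κ⁻¹ * (2 * C * ENNReal.ofReal (κ / (κ - 1))) + 2 * C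
        = 2 * C * (ENNReal.ofReal κ⁻¹ * ENNReal.ofReal (κ / (κ - 1)) + 1) := by ring
      _ = _ := by
        rw [← ENNReal.ofReal_mul (by positivity), ← ENNReal.ofReal_one,
          ← ENNReal.ofReal_add (by positivity) (by norm_num)]
        congr 2
        field_simp
        ring
  refine ⟨B, ENNReal.mul_ne_top (ENNReal.mul_ne_top (by simp) hC) ENNReal.ofReal_ne_top, ?_⟩
  intro φ hφ
  have hφc := hφ.continuous
  obtain ⟨r₀, hr₀, hzero⟩ := h.exists_lintegral_chartLayer_eq_zero (p := p) (by linarith) hφ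
  -- The threshold r₀ depends on φ, but the bound is preserved by the induction with the same `B`,
  -- so it does not affect the constant.
  have main : ∀ j : ℕ, ∀ r, 0 < r → 2 * r ≤ R / 8 → r ≤ 2 ^ j * r₀ →
      ∫⁻ x in chartLayer z e g R r (2 * r), ‖φ x‖ₑ ^ p ≤
        B * ENNReal.ofReal (r ^ σ) * nonlocalEnergy Ω (d + σ) p φ := by
    intro j
    induction j with
    | zero =>
      intro r hr hrR hr0
      rw [hzero r hr hrR (by simpa using hr0)]
      exact zero_le
    | succ j ih =>
      intro r hr hrR hr0
      have ih' := ih (r / 2) (by linarith) (by linarith) (by rw [pow_succ] at hr0; linarith)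
      have e1 := hCφ φ hφc r r (3 * r / 2) (r / 2) hr hrR (by linarith) (by linarith)
        (by linarith) (by linarith)
      have e2 := hCφ φ hφc r (3 * r / 2) (2 * r) r hr hrR (by linarith) (by linarith)
        (by linarith) (by linarith)
      rw [show r - r / 2 = r / 2 by ring, show 3 * r / 2 - r / 2 = 2 * (r / 2) by ring] at e1
      rw [show 3 * r / 2 - r = r / 2 by ring, show 2 * r - r = 2 * (r / 2) by ring] at e2
      have hsub : chartLayer z e g R r (2 * r) ⊆
          chartLayer z e g R r (3 * r / 2) ∪ chartLayer z e g R (3 * r / 2) (2 * r) := by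
        rintro x ⟨h1, h2, h3⟩
        rcases le_or_gt (g x) (3 * r / 2) with h4 | h4
        · exact Or.inl ⟨h1, h2, h4⟩
        · exact Or.inr ⟨h1, h4, h3⟩
      have hr2 : ENNReal.ofReal ((r / 2) ^ σ) =
          ENNReal.ofReal (2⁻¹ ^ σ) * ENNReal.ofReal (r ^ σ) := by
        rw [← ENNReal.ofReal_mul (by positivity), ← Real.mul_rpow (by norm_num) hr.le]
        congr 2; ring
      rw [hr2] at ih'
      set I := ∫⁻ x in chartLayer z e g R (r / 2) (2 * (r / 2)), ‖φ x‖ₑ ^ p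
      set E := nonlocalEnergy Ω (d + σ) p φ
      set w := ENNReal.ofReal (r ^ σ)
      calc ∫⁻ x in chartLayer z e g R r (2 * r), ‖φ x‖ₑ ^ p
          ≤ (ENNReal.ofReal κ * I + C * w * E) + (ENNReal.ofReal κ * I + C * w * E) :=
            (lintegral_mono_set hsub).trans ((lintegral_union_le _ _ _).trans (add_le_add e1 e2))
        _ = 2 * ENNReal.ofReal κ * I + 2 * C * w * E := by ring
        _ ≤ 2 * ENNReal.ofReal κ * (B * (ENNReal.ofReal (2⁻¹ ^ σ) * w) * E) + 2 * C * w * E := by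
            gcongr
        _ = (2 * ENNReal.ofReal κ * ENNReal.ofReal (2⁻¹ ^ σ) * B + 2 * C) * w * E := by ring
        _ = B * w * E := by rw [hBeq]
  intro r hr hrR
  obtain ⟨j, hj⟩ := pow_unbounded_of_one_lt (r / r₀) (one_lt_two)
  exact main j r hr hrR ((div_le_iff₀ hr₀).1 hj.le)

theorem hasLocalPoincare (h : IsBoundaryChart Ω z e g M R) {p σ : ℝ} (hp : 1 < p) (hσ : 1 < σ) :
    HasLocalPoincare Ω (d + σ) p z := by
  obtain ⟨C, hC, hCφ⟩ := h.exists_lintegral_chartLayer_le hp hσ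
  have hR := h.pos
  have hgc := h.continuous
  have hgz := h.height_eq_zero (Metric.mem_ball_self hR) h.mem_frontier
  -- The half-open layers (r k, 2 r k] tile the heights in (0, R/8].
  set r : ℕ → ℝ := fun k => (1 / 2) ^ (k + 1) * (R / 8) with hr
  have hrpow : ∀ k, r k ^ σ = (R / 16) ^ σ * ((1 / 2) ^ σ) ^ k := fun k => by
    rw [← Real.rpow_mul_natCast (by norm_num), mul_comm σ, Real.rpow_natCast_mul (by norm_num),
      ← Real.mul_rpow (by positivity) (by positivity)]
    congr 1
    simp only [hr, pow_succ]; ring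
  have hsum : Summable fun k => r k ^ σ := by
    simp only [hrpow]
    exact (summable_geometric_of_lt_one (by positivity)
      (Real.rpow_lt_one (by norm_num) (by norm_num) (by linarith))).mul_left _
  refine ⟨{x | ‖x - g x • e - z‖ < R / 8} ∩ {x | g x < R / 8} ∩ Metric.ball z R, ?_,
    C * ∑' k, ENNReal.ofReal (r k ^ σ), ENNReal.mul_ne_top hC hsum.tsum_ofReal_ne_top, ?_⟩
  · refine IsOpen.mem_nhds (((isOpen_lt (by fun_prop) continuous_const).inter
      (isOpen_lt hgc continuous_const)).inter Metric.isOpen_ball) ⟨⟨?_, ?_⟩, ?_⟩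
    · simpa [hgz] using hR
    · simpa [hgz] using hR
    · exact Metric.mem_ball_self hR
  intro φ hφ
  have hsub : Ω ∩ ({x | ‖x - g x • e - z‖ < R / 8} ∩ {x | g x < R / 8} ∩ Metric.ball z R) ⊆
      ⋃ k, chartLayer z e g R (r k) (2 * r k) := by
    rintro x ⟨hxΩ, ⟨h1, h2⟩, h3⟩
    have h0 := (h.mem_iff x h3).1 hxΩ
    have h2' : g x < R / 8 := h2
    obtain ⟨k, hk1, hk2⟩ := exists_nat_pow_near_of_lt_one (x := g x / (R / 8)) (y := 1 / 2)
      (by positivity) ((div_le_one (by positivity)).2 h2'.le) (by norm_num) (by norm_num)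
    rw [lt_div_iff₀ (by positivity)] at hk1
    rw [div_le_iff₀ (by positivity)] at hk2
    refine mem_iUnion.2 ⟨k, h1, hk1, hk2.trans_eq ?_⟩
    simp only [hr]; ring
  refine (lintegral_mono_set hsub).trans ((lintegral_iUnion_le _ _).trans ?_)
  rw [← ENNReal.tsum_mul_left, ← ENNReal.tsum_mul_right]
  refine ENNReal.tsum_le_tsum fun k => hCφ φ hφ _ (by positivity) ?_
  have : ((1 : ℝ) / 2) ^ k ≤ 1 := pow_le_one₀ (by norm_num) (by norm_num)
  calc 2 * r k = (1 / 2) ^ k * (R / 8) := by rw [hr]; ring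
    _ ≤ 1 * (R / 8) := by gcongr
    _ = R / 8 := one_mul _

end IsBoundaryChart

/-! ### Globalisation by compactness -/

theorem IsLipschitzDomain.exists_isBoundaryChart {Ω : Set (EuclideanSpace ℝ (Fin d))}
    (hΩ : IsLipschitzDomain Ω) {z : EuclideanSpace ℝ (Fin d)} (hz : z ∈ frontier Ω) :
    ∃ e g M R, IsBoundaryChart Ω z e g M R := by
  obtain ⟨hopen, -, N, O, G, hO, hcov, hG, heq⟩ := hΩ
  obtain ⟨j, hj⟩ := mem_iUnion.1 (hcov hz)
  obtain ⟨R, hR, hRO⟩ := Metric.isOpen_iff.1 (hO j).1 z hj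
  obtain ⟨e, g, M, he, hM, hg, hge, hgG⟩ := (hG j).exists_height
  refine ⟨e, g, M, R, hopen, hz, he, hM, hR, hg, hge, fun x hx => ?_⟩
  have hxO := hRO hx
  rw [← hgG]
  exact ⟨fun hxΩ => ((heq j).subset ⟨hxΩ, hxO⟩).1, fun hxG => ((heq j).superset ⟨hxG, hxO⟩).1⟩

theorem exists_lintegral_le_nonlocalEnergy {Ω : Set (EuclideanSpace ℝ (Fin d))} (hd : 0 < d)
    (hΩ : IsLipschitzDomain Ω) (hΩb : Bornology.IsBounded Ω) {p σ : ℝ} (hp : 1 < p) (hσ : 1 < σ) :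
    ∃ C : ℝ≥0∞, C ≠ ∞ ∧ ∀ φ, IsLipschitzCompactlySupportedIn Ω φ →
      ∫⁻ x in Ω, ‖φ x‖ₑ ^ p ≤ C * nonlocalEnergy Ω (d + σ) p φ := by
  have hbd : ∀ z ∈ frontier Ω, HasLocalPoincare Ω (d + σ) p z := fun z hz => by
    obtain ⟨e, g, M, R, h⟩ := hΩ.exists_isBoundaryChart hz
    exact h.hasLocalPoincare hp hσ
  have hall : ∀ x ∈ closure Ω, HasLocalPoincare Ω (d + σ) p x := fun x hx => by
    by_cases hxΩ : x ∈ Ω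
    · refine hasLocalPoincare_of_mem hp.le (by positivity) hΩ.1 ?_ hbd hxΩ
      have : Nonempty (Fin d) := ⟨⟨0, hd⟩⟩
      refine nonempty_frontier_iff.2 ⟨⟨x, hxΩ⟩, fun huniv => ?_⟩
      rw [huniv] at hΩb
      exact NormedSpace.unbounded_univ ℝ _ hΩb
    · refine hbd x ?_
      rw [hΩ.1.frontier_eq]
      exact ⟨hx, hxΩ⟩
  have key : ∃ C : ℝ≥0∞, C ≠ ∞ ∧ ∀ φ, IsLipschitzCompactlySupportedIn Ω φ →
      ∫⁻ x in Ω ∩ closure Ω, ‖φ x‖ₑ ^ p ≤ C * nonlocalEnergy Ω (d + σ) p φ := by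
    refine IsCompact.induction_on (s := closure Ω) (p := fun S => ∃ C : ℝ≥0∞, C ≠ ∞ ∧
      ∀ φ, IsLipschitzCompactlySupportedIn Ω φ →
      ∫⁻ x in Ω ∩ S, ‖φ x‖ₑ ^ p ≤ C * nonlocalEnergy Ω (d + σ) p φ) hΩb.isCompact_closure
      ⟨0, by simp, by simp⟩ ?_ ?_ ?_
    · rintro S T hST ⟨C, hC, h⟩
      exact ⟨C, hC, fun φ hφ => (lintegral_mono_set (by gcongr)).trans (h φ hφ)⟩
    · rintro S T ⟨C, hC, h⟩ ⟨C', hC', h'⟩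
      refine ⟨C + C', ENNReal.add_ne_top.2 ⟨hC, hC'⟩, fun φ hφ => ?_⟩
      rw [inter_union_distrib_left, add_mul]
      exact (lintegral_union_le _ _ _).trans (add_le_add (h φ hφ) (h' φ hφ))
    · intro x hx
      obtain ⟨U, hU, C, hC, h⟩ := hall x hx
      exact ⟨U, mem_nhdsWithin_of_mem_nhds hU, C, hC, h⟩
  rwa [inter_eq_self_of_subset_left subset_closure] at key

/-! ### Quasi-triangle inequality for the energy and passage to the closure -/

theorem nonlocalEnergy_congr_ae {Ω : Set (EuclideanSpace ℝ (Fin d))} {α p : ℝ}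
    {u v : EuclideanSpace ℝ (Fin d) → ℝ} (h : u =ᵐ[volume.restrict Ω] v) :
    nonlocalEnergy Ω α p u = nonlocalEnergy Ω α p v := by
  refine lintegral_congr_ae ?_
  filter_upwards [h] with x hx
  refine lintegral_congr_ae ?_
  filter_upwards [ae_mono (Measure.restrict_mono_set volume inter_subset_left) h] with y hy
  rw [hx, hy]

theorem nonlocalEnergy_neg (Ω : Set (EuclideanSpace ℝ (Fin d))) (α p : ℝ)
    (u : EuclideanSpace ℝ (Fin d) → ℝ) :
    nonlocalEnergy Ω α p (-u) = nonlocalEnergy Ω α p u := by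
  simp only [nonlocalEnergy, Pi.neg_apply]
  simp only [neg_sub_neg, abs_sub_comm]

theorem nonlocalEnergy_add_le {Ω : Set (EuclideanSpace ℝ (Fin d))} {α p : ℝ} (hp : 1 ≤ p)
    (hΩ : IsOpen Ω) {u v : EuclideanSpace ℝ (Fin d) → ℝ} (hu : Measurable u) :
    nonlocalEnergy Ω α p (u + v) ≤
      2 ^ p * (nonlocalEnergy Ω α p u + nonlocalEnergy Ω α p v) := by
  have hδ : Measurable (bdryDist Ω) := (continuous_bdryDist Ω).measurable
  have h2p : (2 : ℝ≥0∞) ^ p ≠ ∞ := by simp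
  have hp0 : 0 ≤ p := by linarith
  have hpt : ∀ a b c : ℝ, 0 ≤ c → ENNReal.ofReal (|a + b| ^ p / c) ≤
      2 ^ p * (ENNReal.ofReal (|a| ^ p / c) + ENNReal.ofReal (|b| ^ p / c)) := by
    intro a b c hc
    have key := ENNReal.rpow_add_le_two_rpow hp ‖a‖ₑ ‖b‖ₑ
    have key' : ‖a + b‖ₑ ^ p ≤ 2 ^ p * (‖a‖ₑ ^ p + ‖b‖ₑ ^ p) :=
      (ENNReal.rpow_le_rpow (enorm_add_le a b) hp0).trans key
    have conv : ∀ t : ℝ, ENNReal.ofReal (|t| ^ p / c) = ‖t‖ₑ ^ p * ENNReal.ofReal c⁻¹ := fun t => by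
      rw [← ofReal_norm, ENNReal.ofReal_rpow_of_nonneg (norm_nonneg _) hp0, Real.norm_eq_abs,
        ← ENNReal.ofReal_mul (by positivity), div_eq_mul_inv]
    rw [conv, conv, conv, ← add_mul, ← mul_assoc]
    gcongr
  have hjoint : Measurable fun z : EuclideanSpace ℝ (Fin d) × EuclideanSpace ℝ (Fin d) =>
      ENNReal.ofReal (|u z.2 - u z.1| ^ p / bdryDist Ω z.1 ^ α) := by fun_prop
  have hset : MeasurableSet {z : EuclideanSpace ℝ (Fin d) × EuclideanSpace ℝ (Fin d) |
      z.2 ∈ Ω ∩ Metric.ball z.1 (bdryDist Ω z.1)} := by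
    refine (hΩ.measurableSet.preimage measurable_snd).inter ?_
    exact (isOpen_lt (continuous_snd.dist continuous_fst)
      ((continuous_bdryDist Ω).comp continuous_fst)).measurableSet
  have hinner : Measurable fun x => ∫⁻ y in Ω ∩ Metric.ball x (bdryDist Ω x),
      ENNReal.ofReal (|u y - u x| ^ p / bdryDist Ω x ^ α) := by
    have := (hjoint.indicator hset).lintegral_prod_right' (ν := volume)
    refine (congrArg Measurable (funext fun x => ?_)).mp this
    rw [← lintegral_indicator (hΩ.measurableSet.inter measurableSet_ball)]
    rfl
  simp only [nonlocalEnergy]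
  rw [← lintegral_add_left hinner, ← lintegral_const_mul' _ _ h2p]
  refine lintegral_mono fun x => ?_
  simp only
  rw [← lintegral_add_left (by fun_prop), ← lintegral_const_mul' _ _ h2p]
  refine lintegral_mono fun y => ?_
  have : (u + v) y - (u + v) x = (u y - u x) + (v y - v x) := by
    simp only [Pi.add_apply]; ring
  rw [this]
  exact hpt _ _ _ (Real.rpow_nonneg Metric.infDist_nonneg _)

end

theorem proposition5p3 (d : ℕ) (hd : 2 ≤ d) (Ω : Set (EuclideanSpace ℝ (Fin d)))
    (hΩ : IsLipschitzDomain Ω) (hΩb : Bornology.IsBounded Ω)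
    (s p : ℝ) (hp : 1 < p) (hs0 : 0 < s) (hs1 : s ≤ 1) (hps : 1 < p * s) :
    ∃ C : ℝ, 0 < C ∧ ∀ u : EuclideanSpace ℝ (Fin d) → ℝ, MemNonlocalZero Ω s p u →
      lpNormOn Ω p u ≤ ENNReal.ofReal C * nonlocalSeminorm Ω s p u := by
  obtain ⟨C, hC, hCφ⟩ := exists_lintegral_le_nonlocalEnergy (by omega) hΩ hΩb hp hps
  have hp0 : 0 < p := by linarith
  have hp1 : (0 : ℝ) ≤ 1 / p := by positivity
  have hsemi : ∀ u, nonlocalSeminorm Ω s p u = nonlocalEnergy Ω (d + p * s) p u ^ (1 / p) :=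
    fun u => rfl
  have hlp : ∀ u : EuclideanSpace ℝ (Fin d) → ℝ,
      lpNormOn Ω p u = (∫⁻ x in Ω, ‖u x‖ₑ ^ p) ^ (1 / p) := fun u => by
    rw [lpNormOn, eLpNorm_eq_lintegral_rpow_enorm_toReal (by simpa using hp0)
      ENNReal.ofReal_ne_top, ENNReal.toReal_ofReal hp0.le]
  set K : ℝ≥0∞ := C ^ (1 / p) * 2 with hK
  have hKt : K ≠ ∞ := ENNReal.mul_ne_top (ENNReal.rpow_ne_top_of_nonneg hp1 hC) (by simp)
  refine ⟨K.toReal + 1, by positivity, fun u hu => ?_⟩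
  obtain ⟨hmem, -, happrox⟩ := hu
  have hbound : ∀ ε : ℝ≥0∞, 0 < ε →
      lpNormOn Ω p u ≤ K * nonlocalSeminorm Ω s p u + (K + 1) * ε := by
    intro ε hε
    obtain ⟨φ, hφ, hnorm⟩ := happrox ε hε
    have hlpd : lpNormOn Ω p (u - φ) ≤ ε := by
      refine le_trans ?_ hnorm.le
      rw [nonlocalNorm, one_div, ENNReal.le_rpow_inv_iff hp0]
      exact le_self_add
    have hsd : nonlocalSeminorm Ω s p (u - φ) ≤ ε := by
      refine le_trans ?_ hnorm.le
      rw [nonlocalNorm, one_div, ENNReal.le_rpow_inv_iff hp0]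
      exact le_add_self
    have hφm : AEStronglyMeasurable φ (volume.restrict Ω) := hφ.continuous.aestronglyMeasurable
    have htri : lpNormOn Ω p u ≤ lpNormOn Ω p φ + lpNormOn Ω p (u - φ) := by
      have := eLpNorm_add_le (p := ENNReal.ofReal p) hφm (hmem.1.sub hφm)
        (by simpa using hp.le)
      rwa [add_sub_cancel] at this
    have henergy : nonlocalEnergy Ω (d + p * s) p φ ≤ 2 ^ p *
        (nonlocalEnergy Ω (d + p * s) p u + nonlocalEnergy Ω (d + p * s) p (u - φ)) := by
      -- Splitting the double integral needs a measurable summand, so u is replaced by an a.e. equal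
      -- measurable representative.
      obtain ⟨v, hv, huv⟩ := hmem.1
      have h1 := nonlocalEnergy_add_le (α := d + p * s) hp.le hΩ.1 hv.measurable (v := φ - v)
      have h2 : φ - v =ᵐ[volume.restrict Ω] -(u - φ) := by
        filter_upwards [huv] with x hx
        simp [hx]
      rwa [add_sub_cancel, nonlocalEnergy_congr_ae h2, nonlocalEnergy_neg,
        ← nonlocalEnergy_congr_ae huv] at h1
    have hφK : lpNormOn Ω p φ ≤
        K * (nonlocalSeminorm Ω s p u + nonlocalSeminorm Ω s p (u - φ)) := by
      rw [hlp, hsemi, hsemi, hK]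
      calc (∫⁻ x in Ω, ‖φ x‖ₑ ^ p) ^ (1 / p)
          ≤ (C * (2 ^ p * (nonlocalEnergy Ω (d + p * s) p u +
              nonlocalEnergy Ω (d + p * s) p (u - φ)))) ^ (1 / p) := by
            refine ENNReal.rpow_le_rpow ((hCφ φ hφ).trans ?_) hp1
            gcongr
        _ = C ^ (1 / p) * 2 * (nonlocalEnergy Ω (d + p * s) p u +
              nonlocalEnergy Ω (d + p * s) p (u - φ)) ^ (1 / p) := by
            rw [ENNReal.mul_rpow_of_nonneg _ _ hp1, ENNReal.mul_rpow_of_nonneg _ _ hp1,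
              ← ENNReal.rpow_mul, mul_one_div_cancel hp0.ne', ENNReal.rpow_one, mul_assoc]
        _ ≤ _ := by
            gcongr
            exact ENNReal.rpow_add_le_add_rpow _ _ hp1 ((div_le_one hp0).2 hp.le)
    calc lpNormOn Ω p u ≤ lpNormOn Ω p φ + lpNormOn Ω p (u - φ) := htri
      _ ≤ K * (nonlocalSeminorm Ω s p u + ε) + ε := by
          refine add_le_add (hφK.trans ?_) hlpd
          gcongr
      _ = _ := by ring
  have hlim : lpNormOn Ω p u ≤ K * nonlocalSeminorm Ω s p u := by
    refine ENNReal.le_of_forall_pos_le_add fun ε hε _ => ?_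
    have hK1 : K + 1 ≠ ∞ := ENNReal.add_ne_top.2 ⟨hKt, by simp⟩
    have hK0 : K + 1 ≠ 0 := by simp
    have hpos : 0 < (ε : ℝ≥0∞) / (K + 1) :=
      ENNReal.div_pos (by simpa using hε.ne') hK1
    refine (hbound _ hpos).trans_eq ?_
    rw [ENNReal.mul_div_cancel hK0 hK1]
  refine hlim.trans ?_
  gcongr
  rw [ENNReal.ofReal_add (by positivity) (by norm_num), ENNReal.ofReal_toReal hKt]
  exact le_self_add
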